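/- Equip $\mathbb{R}$ with the asymmetric hemi-norm $u(x)=\max\{x,0\}$, the induced quasi-hemi-metric $d_u(x,y)=u(y-x)$, and the base point $0$. Let $\mathrm{SLip}_0(\mathbb{R},u)$ be the cone of functions $f:\mathbb{R}\to\mathbb{R}$ with $f(0)=0$ for which there is $L>0$ with $f(x)-f(y)\le L\,d_u(y,x)$ for all $x,y\in\mathbb{R}$, and let $\|f|_S$ be the infimum of all such $L$. For $x\in\mathbb{R}$ let $\delta_x$ be the evaluation functional $f\mapsto f(x)$ on $\mathrm{SLip}_0(\mathbb{R},u)$, and for $\mu$ in the real linear span of $\{\delta_x : x\in\mathbb{R}\}$ put $\|\mu|^*=\sup\{\mu(f) : f\in\mathrm{SLip}_0(\mathbb{R},u),\ \|f|_S\le 1\}$. The semi-Lipschitz free space $\mathcal{F}_a(\mathbb{R},u)$ is the bicompletion of $(\mathrm{span}\{\delta_x : x\in\mathbb{R}\},\|\cdot|^*)$, i.e. its completion for the symmetrized norm $\|\mu|^*+\|{-\mu}|^*$, with $\|\cdot|^*$ extended by continuity. **Theorem.** $\mathcal{F}_a(\mathbb{R},u)$ is isometrically isomorphic to $(L^1(\mathbb{R}),\|\cdot|_{1,+})$,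 where $\|f|_{1,+}=\int_{\mathbb{R}}\max\{f,0\}\,d\lambda$ and $\lambda$ is the Lebesgue measure. That is, there is a linear bijection $\Phi:\mathcal{F}_a(\mathbb{R},u)\to L^1(\mathbb{R})$ with $\|\Phi(\mu_2)-\Phi(\mu_1)|_{1,+}=\|\mu_2-\mu_1|^*$ for all $\mu_1,\mu_2\in\mathcal{F}_a(\mathbb{R},u)$. -/

import Mathlib

open scoped NNReal ENNReal
open MeasureTheory

noncomputable section

/-- A quasi-hemi-metric: finite valued, with the triangle inequality, and separating points
through `d x y` and `d y x` jointly.  (Quasi-metrics, where `d x y = 0` alone forces `x = y`,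
are a special case.) -/
structure QuasiHemiMetric (X : Type*) where
  toFun : X → X → ℝ
  nonneg : ∀ x y, 0 ≤ toFun x y
  triangle : ∀ x y z, toFun x y ≤ toFun x z + toFun z y
  eq_iff : ∀ x y, x = y ↔ toFun x y = 0 ∧ toFun y x = 0

namespace QuasiHemiMetric

variable {X Y : Type*}

instance : CoeFun (QuasiHemiMetric X) (fun _ => X → X → ℝ) := ⟨toFun⟩

/-- The symmetrized distance `d^s(x,y) = d(x,y) + d(y,x)`. -/
def symmDist (d : QuasiHemiMetric X) (x y : X) : ℝ := d x y + d y x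

/-- `(Y, e)` together with `ι : X → Y` is a bicompletion of `(X, d)`: `ι` is isometric, its image
is dense for the symmetrized distance of `Y`, and `Y` is complete for that distance. -/
structure IsBicompletion (d : QuasiHemiMetric X) (e : QuasiHemiMetric Y) (ι : X → Y) : Prop where
  isometric : ∀ x y, e (ι x) (ι y) = d x y
  dense : ∀ y, ∀ ε > 0, ∃ x, e.symmDist (ι x) y < ε
  complete : ∀ s : ℕ → Y,
    (∀ ε > 0, ∃ N, ∀ m ≥ N, ∀ n ≥ N, e.symmDist (s m) (s n) < ε) →
      ∃ y, ∀ ε > 0, ∃ N, ∀ n ≥ N, e.symmDist (s n) y < ε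

end QuasiHemiMetric

/-- An asymmetric hemi-norm on a real vector space. -/
structure AsymHemiNorm (E : Type*) [AddCommGroup E] [Module ℝ E] where
  toFun : E → ℝ
  nonneg : ∀ x, 0 ≤ toFun x
  add_le : ∀ x y, toFun (x + y) ≤ toFun x + toFun y
  smul_pos : ∀ (r : ℝ) (x : E), 0 < r → toFun (r • x) = r * toFun x
  eq_zero_iff : ∀ x, x = 0 ↔ toFun x = 0 ∧ toFun (-x) = 0

/-- A conic hemi-norm on a cone, a cone being an abelian monoid with an action of the nonnegative
reals. In the last axiom `z` plays the role of `-x`, which need not exist. -/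
structure ConicHemiNorm (C : Type*) [AddCommMonoid C] [Module ℝ≥0 C] where
  toFun : C → ℝ
  nonneg : ∀ x, 0 ≤ toFun x
  add_le : ∀ x y, toFun (x + y) ≤ toFun x + toFun y
  smul_pos : ∀ (r : ℝ≥0) (x : C), 0 < r → toFun (r • x) = r * toFun x
  eq_zero : ∀ x z, x + z = 0 → toFun x = 0 → toFun z = 0 → x = 0

namespace AsymHemiNorm

variable {E F : Type*} [AddCommGroup E] [Module ℝ E] [AddCommGroup F] [Module ℝ F]

instance : CoeFun (AsymHemiNorm E) (fun _ => E → ℝ) := ⟨toFun⟩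

theorem map_zero (p : AsymHemiNorm E) : p 0 = 0 := ((p.eq_zero_iff 0).1 rfl).1

theorem symm_add_le (p : AsymHemiNorm E) (x y : E) :
    p (x + y) + p (-(x + y)) ≤ (p x + p (-x)) + (p y + p (-y)) := by
  have h1 := p.add_le x y
  have h2 := p.add_le (-x) (-y)
  rw [neg_add]
  linarith

theorem eq_zero_of_symm (p : AsymHemiNorm E) (x : E) (h : p x + p (-x) = 0) : x = 0 := by
  have h1 := p.nonneg x
  have h2 := p.nonneg (-x)
  exact (p.eq_zero_iff x).2 ⟨by linarith, by linarith⟩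

theorem sub_le_symm (p : AsymHemiNorm E) (x y : E) :
    p x - p y ≤ p (x - y) + p (-(x - y)) := by
  have h := p.add_le y (x - y)
  rw [add_sub_cancel] at h
  have h2 := p.nonneg (-(x - y))
  linarith

/-- The quasi-hemi-metric `d(x,y) = ‖y - x|`. -/
def dist (p : AsymHemiNorm E) : QuasiHemiMetric E where
  toFun x y := p (y - x)
  nonneg x y := p.nonneg _
  triangle x y z := by
    have h := p.add_le (z - x) (y - z)
    rwa [sub_add_sub_cancel'] at h
  eq_iff x y := by
    rw [← neg_sub y x, ← p.eq_zero_iff, sub_eq_zero, eq_comm]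

/-- `(E, p)` and `(F, q)` are isometrically isomorphic: there is a linear bijection which is an
isometry for the induced quasi-hemi-metrics. -/
def IsometricallyIsomorphic (p : AsymHemiNorm E) (q : AsymHemiNorm F) : Prop :=
  ∃ Φ : E ≃ₗ[ℝ] F, ∀ x y, q.dist (Φ x) (Φ y) = p.dist x y

/-- A copy of `E`, normed by the symmetrization of `p`. -/
def Symm (_p : AsymHemiNorm E) : Type _ := E

variable (p : AsymHemiNorm E)

instance : AddCommGroup p.Symm := inferInstanceAs (AddCommGroup E)

instance : Module ℝ p.Symm := inferInstanceAs (Module ℝ E)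

/-- The symmetrized norm `‖x‖_s = ‖x| + ‖-x|`. -/
def symmNorm : AddGroupNorm p.Symm where
  toFun x := p.toFun x + p.toFun (-x)
  map_zero' := by
    have h := p.map_zero
    change p.toFun (0 : E) + p.toFun (-(0 : E)) = 0
    rw [neg_zero, h, add_zero]
  add_le' x y := p.symm_add_le x y
  neg' x := by
    change p.toFun (-x : E) + p.toFun (-(-x) : E) = p.toFun (x : E) + p.toFun (-x : E)
    rw [neg_neg, add_comm]
  eq_zero_of_map_eq_zero' x h := p.eq_zero_of_symm x h

instance : NormedAddCommGroup p.Symm := p.symmNorm.toNormedAddCommGroup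

theorem norm_symm_def (x : p.Symm) : ‖x‖ = p.toFun x + p.toFun (-x) := rfl

instance : NormedSpace ℝ p.Symm where
  norm_smul_le r x := by
    have key : ∀ (s : ℝ) (y : p.Symm), 0 < s → ‖s • y‖ = s * ‖y‖ := by
      intro s y hs
      rw [norm_symm_def, norm_symm_def, ← smul_neg, mul_add]
      exact congrArg₂ (· + ·) (p.smul_pos s y hs) (p.smul_pos s (-y) hs)
    rcases lt_trichotomy r 0 with h | h | h
    · rw [← norm_neg (r • x), ← neg_smul, key _ _ (neg_pos.2 h), Real.norm_eq_abs, abs_of_neg h]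
    · simp [h]
    · rw [key _ _ h, Real.norm_eq_abs, abs_of_pos h]

/-- The underlying space of the bicompletion of `(E, p)`: the completion of `E` for the
symmetrized norm. -/
abbrev Bicompletion : Type _ := UniformSpace.Completion p.Symm

theorem toFun_sub_le (x y : p.Symm) : p.toFun x - p.toFun y ≤ ‖x - y‖ := by
  rw [norm_symm_def]
  exact p.sub_le_symm x y

theorem lipschitz_toFun : LipschitzWith 1 (fun x : p.Symm => p.toFun x) := by
  refine LipschitzWith.of_dist_le_mul fun x y => ?_
  rw [NNReal.coe_one, one_mul, Real.dist_eq, dist_eq_norm, abs_le]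
  have h1 := p.toFun_sub_le x y
  have h2 := p.toFun_sub_le y x
  rw [norm_sub_rev] at h2
  exact ⟨by linarith, h1⟩

/-- The extension of `p` to the completion by continuity. -/
def extFun : p.Bicompletion → ℝ := UniformSpace.Completion.extension (fun x : p.Symm => p.toFun x)

theorem continuous_extFun : Continuous p.extFun := UniformSpace.Completion.continuous_extension

theorem extFun_coe (x : p.Symm) : p.extFun (x : p.Bicompletion) = p.toFun x :=
  UniformSpace.Completion.extension_coe p.lipschitz_toFun.uniformContinuous x

theorem extFun_add_neg (x : p.Bicompletion) : p.extFun x + p.extFun (-x) = ‖x‖ := by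
  induction x using UniformSpace.Completion.induction_on with
  | hp =>
    exact isClosed_eq (p.continuous_extFun.add (p.continuous_extFun.comp continuous_neg))
      continuous_norm
  | ih x =>
    rw [← UniformSpace.Completion.coe_neg, extFun_coe, extFun_coe,
      UniformSpace.Completion.norm_coe, norm_symm_def]

theorem extFun_nonneg (x : p.Bicompletion) : 0 ≤ p.extFun x := by
  induction x using UniformSpace.Completion.induction_on with
  | hp => exact isClosed_le continuous_const p.continuous_extFun
  | ih x => rw [extFun_coe]; exact p.nonneg _

/-- The asymmetric hemi-norm of the bicompletion of `(E, p)`. -/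
def bicompletion : AsymHemiNorm p.Bicompletion where
  toFun := p.extFun
  nonneg := p.extFun_nonneg
  add_le x y := by
    induction x, y using UniformSpace.Completion.induction_on₂ with
    | hp =>
      exact isClosed_le (p.continuous_extFun.comp continuous_add)
        ((p.continuous_extFun.comp continuous_fst).add (p.continuous_extFun.comp continuous_snd))
    | ih x y =>
      rw [← UniformSpace.Completion.coe_add, extFun_coe, extFun_coe, extFun_coe]
      exact p.add_le _ _
  smul_pos r x hr := by
    induction x using UniformSpace.Completion.induction_on with
    | hp =>
      exact isClosed_eq (p.continuous_extFun.comp (continuous_const_smul r))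
        (continuous_const.mul p.continuous_extFun)
    | ih x =>
      rw [← UniformSpace.Completion.coe_smul, extFun_coe, extFun_coe]
      exact p.smul_pos _ _ hr
  eq_zero_iff x := by
    have h := p.extFun_add_neg x
    have h1 := p.extFun_nonneg x
    have h2 := p.extFun_nonneg (-x)
    rw [← norm_eq_zero (a := x)]
    constructor
    · intro h0
      exact ⟨by linarith, by linarith⟩
    · rintro ⟨h3, h4⟩
      linarith

/-- The canonical map of `E` into the bicompletion. -/
def toBicompletion : E →ₗ[ℝ] p.Bicompletion :=
  (UniformSpace.Completion.toComplₗᵢ : p.Symm →ₗᵢ[ℝ] p.Bicompletion).toLinearMap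

theorem symmDist_bicompletion (x y : p.Bicompletion) :
    p.bicompletion.dist.symmDist x y = ‖x - y‖ := by
  rw [← p.extFun_add_neg, neg_sub, add_comm]
  rfl

theorem isBicompletion : p.dist.IsBicompletion p.bicompletion.dist p.toBicompletion where
  isometric x y := by
    change p.extFun (p.toBicompletion y - p.toBicompletion x) = p (y - x)
    rw [← _root_.map_sub]
    exact p.extFun_coe _
  dense y ε hε := by
    obtain ⟨x, hx⟩ := Metric.denseRange_iff.1
      (UniformSpace.Completion.denseRange_coe (α := p.Symm)) y ε hε
    refine ⟨x, ?_⟩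
    rw [symmDist_bicompletion, norm_sub_rev, ← dist_eq_norm]
    exact hx
  complete s hs := by
    simp only [symmDist_bicompletion, ← dist_eq_norm] at hs ⊢
    have hc : CauchySeq s := Metric.cauchySeq_iff.2 hs
    obtain ⟨y, hy⟩ := cauchySeq_tendsto_of_complete hc
    exact ⟨y, Metric.tendsto_atTop.1 hy⟩

end AsymHemiNorm

namespace ConicHemiNorm

variable {C : Type*} [AddCommMonoid C] [Module ℝ≥0 C]

instance : CoeFun (ConicHemiNorm C) (fun _ => C → ℝ) := ⟨toFun⟩

theorem map_zero (p : ConicHemiNorm C) : p 0 = 0 := by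
  have h := p.smul_pos 2 0 (by norm_num)
  rw [smul_zero] at h
  have h2 : ((2 : ℝ≥0) : ℝ) = 2 := rfl
  rw [h2] at h
  linarith

/-- The extended quasi-hemi-metric `d_e(x,y) = inf {‖z| : y = x + z}` (`∞` if there is no
such `z`). -/
def edist (p : ConicHemiNorm C) (x y : C) : ℝ≥0∞ :=
  ⨅ (z : C) (_ : y = x + z), ENNReal.ofReal (p z)

/-- A linear functional on `C` is semi-Lipschitz for `d_e` iff it is bounded above by a multiple
of the conic hemi-norm. -/
theorem semiLipschitz_iff (p : ConicHemiNorm C) (φ : C →ₗ[ℝ≥0] ℝ) :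
    (∃ L : ℝ, 0 < L ∧ ∀ x y, ENNReal.ofReal (φ x - φ y) ≤ ENNReal.ofReal L * p.edist y x) ↔
      ∃ L : ℝ, 0 < L ∧ ∀ x, φ x ≤ L * p x := by
  constructor
  · rintro ⟨L, hL, h⟩
    refine ⟨L, hL, fun x => ?_⟩
    have h1 := h x 0
    rw [_root_.map_zero, sub_zero] at h1
    have h2 : p.edist 0 x ≤ ENNReal.ofReal (p x) := iInf₂_le x (zero_add x).symm
    have h3 : ENNReal.ofReal (φ x) ≤ ENNReal.ofReal (L * p x) := by
      rw [ENNReal.ofReal_mul hL.le]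
      exact h1.trans (by gcongr)
    exact (ENNReal.ofReal_le_ofReal_iff (mul_nonneg hL.le (p.nonneg x))).1 h3
  · rintro ⟨L, hL, h⟩
    refine ⟨L, hL, fun x y => ?_⟩
    rw [edist, ENNReal.mul_iInf_of_ne (by simpa using hL) ENNReal.ofReal_ne_top]
    refine le_iInf fun z => ?_
    rw [ENNReal.mul_iInf_of_ne (by simpa using hL) ENNReal.ofReal_ne_top]
    refine le_iInf fun hz => ?_
    rw [← ENNReal.ofReal_mul hL.le, hz, map_add, add_sub_cancel_left]
    exact ENNReal.ofReal_le_ofReal (h z)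

/-- The dual cone of `(C, p)`: the linear functionals that are semi-Lipschitz for the extended
quasi-hemi-metric `d_e` and the quasi-hemi-metric `(s, t) ↦ max (t - s) 0` of the real line. -/
def dualCone (p : ConicHemiNorm C) : Submodule ℝ≥0 (C →ₗ[ℝ≥0] ℝ) where
  carrier := {φ | ∃ L : ℝ, 0 < L ∧
    ∀ x y, ENNReal.ofReal (φ x - φ y) ≤ ENNReal.ofReal L * p.edist y x}
  zero_mem' := ⟨1, one_pos, fun x y => by simp⟩
  add_mem' {φ ψ} hφ hψ := by
    change ∃ L : ℝ, _
    obtain ⟨L, hL, h⟩ := (p.semiLipschitz_iff φ).1 hφ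
    obtain ⟨M, hM, h'⟩ := (p.semiLipschitz_iff ψ).1 hψ
    refine (p.semiLipschitz_iff (φ + ψ)).2 ⟨L + M, add_pos hL hM, fun x => ?_⟩
    rw [LinearMap.add_apply, add_mul]
    exact add_le_add (h x) (h' x)
  smul_mem' r φ hφ := by
    change ∃ L : ℝ, _
    obtain ⟨L, hL, h⟩ := (p.semiLipschitz_iff φ).1 hφ
    refine (p.semiLipschitz_iff (r • φ)).2 ⟨r * L + 1, by positivity, fun x => ?_⟩
    have h1 : (r • φ) x = (r : ℝ) * φ x := rfl
    have h2 := mul_le_mul_of_nonneg_left (h x) r.2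
    have h3 := p.nonneg x
    change (r : ℝ) * φ x ≤ r * (L * p x) at h2
    rw [h1]
    nlinarith

theorem mem_dualCone_iff (p : ConicHemiNorm C) (φ : C →ₗ[ℝ≥0] ℝ) :
    φ ∈ p.dualCone ↔ ∃ L : ℝ, 0 < L ∧ ∀ x, φ x ≤ L * p x :=
  p.semiLipschitz_iff φ

/-- The dual conic-norm `‖φ|* = sup {max (φ x) 0 : ‖x| ≤ 1}`; a finite supremum for `φ` in the
dual cone. -/
def dualNorm (p : ConicHemiNorm C) (φ : C →ₗ[ℝ≥0] ℝ) : ℝ :=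
  sSup ((fun x => max (φ x) 0) '' {x | p x ≤ 1})

theorem bddAbove_dualNorm (p : ConicHemiNorm C) {φ : C →ₗ[ℝ≥0] ℝ} (hφ : φ ∈ p.dualCone) :
    BddAbove ((fun x => max (φ x) 0) '' {x | p x ≤ 1}) := by
  obtain ⟨L, hL, h⟩ := (p.mem_dualCone_iff φ).1 hφ
  refine ⟨L, ?_⟩
  rintro _ ⟨x, hx, rfl⟩
  have hx' : p x ≤ 1 := hx
  exact max_le ((h x).trans (by nlinarith)) hL.le

theorem le_dualNorm (p : ConicHemiNorm C) {φ : C →ₗ[ℝ≥0] ℝ} (hφ : φ ∈ p.dualCone) {x : C}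
    (hx : p x ≤ 1) : max (φ x) 0 ≤ p.dualNorm φ :=
  le_csSup (p.bddAbove_dualNorm hφ) ⟨x, hx, rfl⟩

theorem dualNorm_le (p : ConicHemiNorm C) {φ : C →ₗ[ℝ≥0] ℝ} {M : ℝ}
    (h : ∀ x, p x ≤ 1 → max (φ x) 0 ≤ M) : p.dualNorm φ ≤ M := by
  refine csSup_le ⟨_, 0, ?_, rfl⟩ ?_
  · change p 0 ≤ 1
    rw [p.map_zero]
    exact zero_le_one
  · rintro _ ⟨x, hx, rfl⟩
    exact h x hx

theorem dualNorm_nonneg (p : ConicHemiNorm C) (φ : C →ₗ[ℝ≥0] ℝ) : 0 ≤ p.dualNorm φ :=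
  Real.sSup_nonneg (by rintro _ ⟨x, -, rfl⟩; exact le_max_right _ _)

theorem dualNorm_add_le (p : ConicHemiNorm C) {φ ψ : C →ₗ[ℝ≥0] ℝ} (hφ : φ ∈ p.dualCone)
    (hψ : ψ ∈ p.dualCone) : p.dualNorm (φ + ψ) ≤ p.dualNorm φ + p.dualNorm ψ := by
  refine p.dualNorm_le fun x hx => ?_
  have h1 := p.le_dualNorm hφ hx
  have h2 := p.le_dualNorm hψ hx
  rw [LinearMap.add_apply]
  refine max_le ?_ (add_nonneg (p.dualNorm_nonneg _) (p.dualNorm_nonneg _))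
  exact add_le_add ((le_max_left _ _).trans h1) ((le_max_left _ _).trans h2)

theorem dualNorm_smul (p : ConicHemiNorm C) {r : ℝ} (hr : 0 < r) (φ : C →ₗ[ℝ≥0] ℝ) :
    p.dualNorm (r • φ) = r * p.dualNorm φ := by
  rw [dualNorm, dualNorm, ← smul_eq_mul r (sSup _), ← Real.sSup_smul_of_nonneg hr.le,
    ← Set.image_smul, Set.image_image]
  refine congrArg sSup (Set.image_congr fun x _ => ?_)
  rw [LinearMap.smul_apply, smul_eq_mul, smul_eq_mul, mul_max_of_nonneg _ _ hr.le, mul_zero]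

/-- If both `φ` and `-φ` are in the dual cone and have dual norm zero, then `φ = 0`. -/
theorem eq_zero_of_dualNorm (p : ConicHemiNorm C) {φ : C →ₗ[ℝ≥0] ℝ} (hφ : φ ∈ p.dualCone)
    (hφ' : -φ ∈ p.dualCone) (h : p.dualNorm φ = 0) (h' : p.dualNorm (-φ) = 0) : φ = 0 := by
  ext x
  have hp := p.nonneg x
  set r : ℝ≥0 := (⟨p x, hp⟩ + 1)⁻¹ with hr
  have hr0 : 0 < r := by rw [hr]; positivity
  have hrx : p (r • x) ≤ 1 := by
    rw [p.smul_pos r x hr0, hr]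
    change (p x + 1)⁻¹ * p x ≤ 1
    rw [inv_mul_le_iff₀ (by linarith)]
    linarith
  have h1 := (le_max_left _ _).trans (p.le_dualNorm hφ hrx)
  have h2 := (le_max_left _ _).trans (p.le_dualNorm hφ' hrx)
  rw [h] at h1
  rw [h', LinearMap.neg_apply] at h2
  have h3 : φ (r • x) = 0 := le_antisymm h1 (by linarith)
  have h4 : (r : ℝ) * φ x = 0 := by rw [map_smul] at h3; exact h3
  exact (mul_eq_zero.1 h4).resolve_left (by exact_mod_cast hr0.ne')

/-- A real vector space `V` of linear functionals contained in the dual cone of `(C, p)`, with the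
restriction of the dual conic-norm. -/
def dualRestrict (p : ConicHemiNorm C) (V : Submodule ℝ (C →ₗ[ℝ≥0] ℝ))
    (hV : ∀ φ ∈ V, φ ∈ p.dualCone) : AsymHemiNorm V where
  toFun φ := p.dualNorm φ
  nonneg φ := p.dualNorm_nonneg _
  add_le φ ψ := p.dualNorm_add_le (hV _ φ.2) (hV _ ψ.2)
  smul_pos r φ hr := p.dualNorm_smul hr _
  eq_zero_iff φ := by
    constructor
    · rintro rfl
      have h : p.dualNorm 0 = 0 :=
        le_antisymm (p.dualNorm_le fun x _ => by simp) (p.dualNorm_nonneg _)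
      simpa using h
    · rintro ⟨h, h'⟩
      exact Subtype.ext (p.eq_zero_of_dualNorm (hV _ φ.2) (hV _ (-φ).2) h h')

end ConicHemiNorm

namespace QuasiHemiMetric

variable {X : Type*} (d : QuasiHemiMetric X) (x₀ : X)

/-- The set of admissible semi-Lipschitz constants of `f`. -/
def slipConstants (f : X → ℝ) : Set ℝ := {L | 0 < L ∧ ∀ x y, f x - f y ≤ L * d y x}

/-- The cone `SLip₀(X, d)` of semi-Lipschitz functions vanishing at the base point. -/
def SLip₀ : Submodule ℝ≥0 (X → ℝ) where
  carrier := {f | (d.slipConstants f).Nonempty ∧ f x₀ = 0}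
  zero_mem' := ⟨⟨1, one_pos, fun x y => by simpa using d.nonneg y x⟩, rfl⟩
  add_mem' {f g} hf hg := by
    obtain ⟨⟨L, hL, h⟩, h0⟩ := hf
    obtain ⟨⟨M, hM, h'⟩, h0'⟩ := hg
    refine ⟨⟨L + M, add_pos hL hM, fun x y => ?_⟩, by simp [h0, h0']⟩
    have h1 := h x y
    have h2 := h' x y
    simp only [Pi.add_apply]
    nlinarith
  smul_mem' r f hf := by
    obtain ⟨⟨L, hL, h⟩, h0⟩ := hf
    refine ⟨⟨r * L + 1, by positivity, fun x y => ?_⟩, by simp [h0]⟩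
    have h1 := mul_le_mul_of_nonneg_left (h x y) r.2
    have h2 := d.nonneg y x
    change (r : ℝ) * (f x - f y) ≤ r * (L * d y x) at h1
    change (r : ℝ) * f x - r * f y ≤ _
    nlinarith

/-- The semi-Lipschitz conic-norm, the infimum of the semi-Lipschitz constants. -/
def slipNorm (f : X → ℝ) : ℝ := sInf (d.slipConstants f)

theorem slipConstants_bddBelow (f : X → ℝ) : BddBelow (d.slipConstants f) :=
  ⟨0, fun _ h => h.1.le⟩

theorem slipNorm_nonneg (f : X → ℝ) : 0 ≤ d.slipNorm f := Real.sInf_nonneg fun _ h => h.1.le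

theorem sub_le_slipNorm {f : X → ℝ} (hf : (d.slipConstants f).Nonempty) (x y : X) :
    f x - f y ≤ d.slipNorm f * d y x := by
  refine le_of_forall_pos_le_add fun ε hε => ?_
  have hd := d.nonneg y x
  obtain ⟨L, hL, hlt⟩ := exists_lt_of_csInf_lt hf
    (lt_add_of_pos_right (d.slipNorm f) (show 0 < ε / (d y x + 1) by positivity))
  have h1 := hL.2 x y
  have h2 : ε / (d y x + 1) * d y x ≤ ε := by
    rw [div_mul_eq_mul_div, div_le_iff₀ (by linarith)]
    nlinarith
  nlinarith

theorem slipNorm_le {f : X → ℝ} {M : ℝ} (hM : 0 ≤ M) (h : ∀ x y, f x - f y ≤ M * d y x) :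
    d.slipNorm f ≤ M := by
  refine le_of_forall_pos_le_add fun ε hε => csInf_le (d.slipConstants_bddBelow f) ?_
  refine ⟨by linarith, fun x y => (h x y).trans ?_⟩
  have := d.nonneg y x
  nlinarith

theorem slipNorm_smul_le (r : ℝ≥0) {f : X → ℝ} (hf : (d.slipConstants f).Nonempty) :
    d.slipNorm (r • f) ≤ r * d.slipNorm f := by
  refine d.slipNorm_le (mul_nonneg r.2 (d.slipNorm_nonneg f)) fun x y => ?_
  have h := mul_le_mul_of_nonneg_left (d.sub_le_slipNorm hf x y) r.2
  change (r : ℝ) * (f x - f y) ≤ r * (d.slipNorm f * d y x) at h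
  change (r : ℝ) * f x - r * f y ≤ _
  nlinarith

/-- The normed cone `(SLip₀(X, d), ‖·|_S)`. -/
def slip : ConicHemiNorm (d.SLip₀ x₀) where
  toFun f := d.slipNorm f
  nonneg f := d.slipNorm_nonneg _
  add_le f g := by
    refine d.slipNorm_le (add_nonneg (d.slipNorm_nonneg _) (d.slipNorm_nonneg _)) fun x y => ?_
    have h1 := d.sub_le_slipNorm f.2.1 x y
    have h2 := d.sub_le_slipNorm g.2.1 x y
    change (f.1 x + g.1 x) - (f.1 y + g.1 y) ≤ _
    nlinarith
  smul_pos r f hr := by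
    refine le_antisymm (d.slipNorm_smul_le r f.2.1) ?_
    have h := d.slipNorm_smul_le r⁻¹ (r • f).2.1
    have h1 : r⁻¹ • ((r • f : d.SLip₀ x₀) : X → ℝ) = f := by
      rw [Submodule.coe_smul, smul_smul, inv_mul_cancel₀ hr.ne', one_smul]
    have hr' : (0 : ℝ) < r := hr
    rwa [h1, NNReal.coe_inv, ← div_eq_inv_mul, le_div_iff₀ hr', mul_comm] at h
  eq_zero f g hfg hf hg := by
    have hsum : ∀ x, f.1 x + g.1 x = 0 := fun x => congrFun (congrArg Subtype.val hfg) x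
    refine Subtype.ext (funext fun x => ?_)
    have h1 := d.sub_le_slipNorm f.2.1 x x₀
    have h2 := d.sub_le_slipNorm g.2.1 x x₀
    rw [hf, zero_mul, f.2.2] at h1
    rw [hg, zero_mul, g.2.2] at h2
    have h3 := hsum x
    change f.1 x = 0
    linarith

/-- The evaluation functional `δ_x : SLip₀(X, d) → ℝ`, `f ↦ f x`. -/
def delta (x : X) : d.SLip₀ x₀ →ₗ[ℝ≥0] ℝ where
  toFun f := f.1 x
  map_add' _ _ := rfl
  map_smul' _ _ := rfl

/-- The linear span of the evaluation functionals. -/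
def deltaSpan : Submodule ℝ (d.SLip₀ x₀ →ₗ[ℝ≥0] ℝ) := Submodule.span ℝ (Set.range (d.delta x₀))

theorem smul_delta_mem_dualCone (c : ℝ) (x : X) : c • d.delta x₀ x ∈ (d.slip x₀).dualCone := by
  refine ((d.slip x₀).mem_dualCone_iff _).2 ⟨|c| * (d x₀ x + d x x₀) + 1, ?_, fun f => ?_⟩
  · have h1 := d.nonneg x₀ x
    have h2 := d.nonneg x x₀
    positivity
  · have h1 := d.sub_le_slipNorm f.2.1 x x₀
    have h2 := d.sub_le_slipNorm f.2.1 x₀ x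
    rw [f.2.2] at h1 h2
    have h3 := d.slipNorm_nonneg f.1
    have h4 := d.nonneg x₀ x
    have h5 := d.nonneg x x₀
    have h6 : |f.1 x| ≤ d.slipNorm f.1 * (d x₀ x + d x x₀) := by
      rw [abs_le]
      constructor <;> nlinarith
    have h7 : c * f.1 x ≤ |c| * |f.1 x| := by
      rw [← abs_mul]
      exact le_abs_self _
    have h8 := mul_le_mul_of_nonneg_left h6 (abs_nonneg c)
    change c * f.1 x ≤ (|c| * (d x₀ x + d x x₀) + 1) * d.slipNorm f.1
    nlinarith

theorem deltaSpan_le_dualCone : ∀ φ ∈ d.deltaSpan x₀, φ ∈ (d.slip x₀).dualCone := by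
  intro φ hφ
  refine Submodule.span_induction
    (p := fun ψ _ => ∀ c : ℝ, c • ψ ∈ (d.slip x₀).dualCone) ?_ ?_ ?_ ?_ hφ 1 |> fun h => by
      rwa [one_smul] at h
  · rintro _ ⟨x, rfl⟩ c
    exact d.smul_delta_mem_dualCone x₀ c x
  · intro c
    rw [smul_zero]
    exact Submodule.zero_mem _
  · intro ψ χ _ _ h h' c
    rw [smul_add]
    exact Submodule.add_mem _ (h c) (h' c)
  · intro a ψ _ h c
    rw [smul_smul]
    exact h _

/-- The asymmetric normed space `(span δ(X), ‖·|*)`. -/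
def deltaSpanNorm : AsymHemiNorm (d.deltaSpan x₀) :=
  (d.slip x₀).dualRestrict (d.deltaSpan x₀) (d.deltaSpan_le_dualCone x₀)

/-- The underlying vector space of the semi-Lipschitz free space `𝓕ₐ(X, d)`, the bicompletion of
`(span δ(X), ‖·|*)`. -/
abbrev FreeSpace : Type _ := (d.deltaSpanNorm x₀).Bicompletion

/-- The asymmetric hemi-norm of the semi-Lipschitz free space `𝓕ₐ(X, d)`. -/
def freeNorm : AsymHemiNorm (d.FreeSpace x₀) := (d.deltaSpanNorm x₀).bicompletion

end QuasiHemiMetric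

/-- The asymmetric hemi-norm `u(x) = max {x, 0}` on the real line. -/
def uNorm : AsymHemiNorm ℝ where
  toFun x := max x 0
  nonneg x := le_max_right _ _
  add_le x y := max_le (add_le_add (le_max_left _ _) (le_max_left _ _))
    (add_nonneg (le_max_right _ _) (le_max_right _ _))
  smul_pos r x hr := by rw [smul_eq_mul, mul_max_of_nonneg _ _ hr.le, mul_zero]
  eq_zero_iff x := by
    rw [max_eq_right_iff, max_eq_right_iff, neg_nonpos]
    exact le_antisymm_iff

/-- The asymmetric hemi-norm `‖f|_{1,+} = ∫ f⁺ dλ` on `L¹(ℝ)`. -/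
def l1PlusNorm : AsymHemiNorm (Lp ℝ 1 (volume : Measure ℝ)) where
  toFun f := ∫ x, max (f x) 0
  nonneg f := integral_nonneg fun x => le_max_right _ _
  add_le f g := by
    rw [← integral_add (L1.integrable_coeFn f).pos_part (L1.integrable_coeFn g).pos_part]
    refine integral_mono_ae (L1.integrable_coeFn (f + g)).pos_part
      ((L1.integrable_coeFn f).pos_part.add (L1.integrable_coeFn g).pos_part) ?_
    filter_upwards [Lp.coeFn_add f g] with x hx
    rw [hx]
    exact max_le (add_le_add (le_max_left _ _) (le_max_left _ _))
      (add_nonneg (le_max_right _ _) (le_max_right _ _))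
  smul_pos r f hr := by
    rw [← integral_const_mul]
    refine integral_congr_ae ?_
    filter_upwards [Lp.coeFn_smul r f] with x hx
    rw [hx, Pi.smul_apply, smul_eq_mul, mul_max_of_nonneg _ _ hr.le, mul_zero]
  eq_zero_iff f := by
    have hneg : ∫ x, max ((-f : Lp ℝ 1 (volume : Measure ℝ)) x) 0 = ∫ x, max (-f x) 0 :=
      integral_congr_ae (by filter_upwards [Lp.coeFn_neg f] with x hx; rw [hx, Pi.neg_apply])
    have hp : ∫ x, max (f x) 0 = 0 ↔ (fun x => max (f x) 0) =ᵐ[volume] 0 :=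
      integral_eq_zero_iff_of_nonneg (fun x => le_max_right _ _) (L1.integrable_coeFn f).pos_part
    have hm : ∫ x, max (-f x) 0 = 0 ↔ (fun x => max (-f x) 0) =ᵐ[volume] 0 :=
      integral_eq_zero_iff_of_nonneg (fun x => le_max_right _ _) (L1.integrable_coeFn f).neg_part
    rw [hneg, hp, hm, Lp.eq_zero_iff_ae_eq_zero]
    constructor
    · intro h
      constructor <;> filter_upwards [h] with x hx <;> simp [hx]
    · rintro ⟨h, h'⟩
      filter_upwards [h, h'] with x hx hx'
      have h1 : f x ≤ 0 := max_eq_right_iff.1 hx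
      have h2 : -f x ≤ 0 := max_eq_right_iff.1 hx'
      exact le_antisymm h1 (neg_nonpos.1 h2)

end

/-!
A function `f` with `f 0 = 0` lies in the unit ball of `SLip₀(ℝ, u)` exactly when it is nondecreasing
and `1`-Lipschitz, that is, when it is a primitive of a density with values in `[0, 1]`. Pairing `f`
with `μ = ∑ c_x δ_x` amounts to integrating this density against the step function
`φ = ∑ c_x • signedIndicator x`, where `signedIndicator x` is the signed indicator of the interval
between `0` and `x`. The supremum over all densities is `∫ φ⁺`, so `δ_x ↦ signedIndicator x`
preserves the asymmetric norms (`deltaSpanNorm_deltaComb`).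

Differentiation of Lipschitz functions is not needed. For the upper bound, `f` and `id - f` are both
nondecreasing, so the Stieltjes measure of `f` is at most Lebesgue measure, and `∑ c_x f(x)` is the
integral of `φ` for the former (`sum_mul_le_integral_posPart`). The bound is attained at the primitive
of the indicator of `{φ > 0}` (`exists_sum_mul_eq_integral_posPart`).

Finitely supported coefficients `ℝ →₀ ℝ` map linearly onto the span of the evaluation functionals,
which is dense in the free space, and into `L¹(ℝ)`, where step functions are dense
(`denseRange_stepL1`). The two maps induce the same asymmetric norm on `ℝ →₀ ℝ`, hence the same
symmetrized norm, which in `L¹(ℝ)` is the usual one. The correspondence therefore extends to a linear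
isometry between the two complete spaces, and the equality of the asymmetric norms passes to the
closure by continuity.
-/

/-! ### Signed indicators of intervals -/

/-- The signed indicator of the interval between `0` and `x`: it is `1` on `(0, x]` if `0 ≤ x` and
`-1` on `(x, 0]` if `x ≤ 0`. It represents the evaluation functional `δ_x`. -/
noncomputable def signedIndicator (x t : ℝ) : ℝ :=
  (Set.Ioc 0 x).indicator (fun _ => (1 : ℝ)) t - (Set.Ioc x 0).indicator (fun _ => (1 : ℝ)) t

/-- The step function `∑ c_x • signedIndicator x` with coefficients `c`. -/
noncomputable def stepFun (c : ℝ →₀ ℝ) (t : ℝ) : ℝ := c.sum fun x a => a * signedIndicator x t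

theorem signedIndicator_sub {a b : ℝ} (hab : a ≤ b) (t : ℝ) :
    signedIndicator b t - signedIndicator a t = (Set.Ioc a b).indicator (fun _ => (1 : ℝ)) t := by
  simp only [signedIndicator, Set.indicator_apply, Set.mem_Ioc]
  grind

theorem integrable_indicator_Ioc (μ : Measure ℝ) [IsLocallyFiniteMeasure μ] (a b : ℝ) :
    Integrable ((Set.Ioc a b).indicator fun _ => (1 : ℝ)) μ :=
  (integrable_indicator_iff measurableSet_Ioc).2 (integrableOn_const measure_Ioc_lt_top.ne)

theorem integrable_signedIndicator (μ : Measure ℝ) [IsLocallyFiniteMeasure μ] (x : ℝ) :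
    Integrable (signedIndicator x) μ :=
  (integrable_indicator_Ioc μ 0 x).sub (integrable_indicator_Ioc μ x 0)

theorem integrable_stepFun (μ : Measure ℝ) [IsLocallyFiniteMeasure μ] (c : ℝ →₀ ℝ) :
    Integrable (stepFun c) μ :=
  integrable_finsetSum _ fun x _ => (integrable_signedIndicator μ x).const_mul _

theorem measurable_signedIndicator (x : ℝ) : Measurable (signedIndicator x) :=
  (measurable_const.indicator measurableSet_Ioc).sub (measurable_const.indicator measurableSet_Ioc)

theorem measurable_stepFun (c : ℝ →₀ ℝ) : Measurable (stepFun c) :=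
  Finset.measurable_fun_sum _ fun x _ => (measurable_signedIndicator x).const_mul _

theorem integral_signedIndicator (f : StieltjesFunction ℝ) (x : ℝ) :
    ∫ t, signedIndicator x t ∂f.measure = f x - f 0 := by
  have h := integral_sub (integrable_indicator_Ioc f.measure 0 x)
    (integrable_indicator_Ioc f.measure x 0)
  rw [integral_indicator_const _ measurableSet_Ioc, integral_indicator_const _ measurableSet_Ioc,
    measureReal_def, measureReal_def, f.measure_Ioc, f.measure_Ioc, smul_eq_mul, smul_eq_mul,
    mul_one, mul_one, ENNReal.toReal_ofReal', ENNReal.toReal_ofReal', ← neg_sub (f x) (f 0),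
    max_comm, max_comm (-_)] at h
  refine h.trans ?_
  rw [max_comm, max_comm 0 (-_)]
  exact max_zero_sub_eq_self _

theorem integral_stepFun (f : StieltjesFunction ℝ) (c : ℝ →₀ ℝ) :
    ∫ t, stepFun c t ∂f.measure = c.sum fun x a => a * (f x - f 0) := by
  simp only [stepFun, Finsupp.sum]
  rw [integral_finsetSum _ fun x _ => (integrable_signedIndicator _ x).const_mul _]
  simp only [integral_const_mul, integral_signedIndicator]

/-! ### The dual norm of a combination of evaluation functionals -/

theorem uNorm_dist_apply (x y : ℝ) : uNorm.dist x y = max (y - x) 0 := rfl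

/-- For a function `f` in the unit ball of `SLip₀(ℝ, u)` both `f` and `id - f` are nondecreasing and
continuous, and their Stieltjes measures add up to Lebesgue measure. -/
theorem exists_stieltjes_le_volume {f : ℝ → ℝ}
    (hf : ∀ x y, f x - f y ≤ uNorm.dist y x) :
    ∃ F : StieltjesFunction ℝ, (∀ x, F x = f x) ∧ F.measure ≤ volume := by
  simp only [uNorm_dist_apply] at hf
  have hm : Monotone f := fun x y hxy => by
    have h := hf x y
    rw [max_eq_right (by linarith)] at h
    linarith
  have hm' : Monotone fun x => x - f x := fun x y hxy => by
    have h := hf y x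
    rw [max_eq_left (by linarith)] at h
    change x - f x ≤ y - f y
    linarith
  have hc : Continuous f := by
    refine (LipschitzWith.of_le_add_mul 1 fun x y => ?_).continuous
    have h := hf x y
    have h' : max (x - y) 0 ≤ dist x y := max_le (le_abs_self _) dist_nonneg
    rw [NNReal.coe_one, one_mul]
    linarith
  let F : StieltjesFunction ℝ := ⟨f, hm, fun x => hc.continuousWithinAt⟩
  let G : StieltjesFunction ℝ :=
    ⟨fun x => x - f x, hm', fun x => (continuous_id.sub hc).continuousWithinAt⟩
  have hFG : F + G = StieltjesFunction.id :=
    StieltjesFunction.ext fun x => add_sub_cancel (f x) x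
  refine ⟨F, fun _ => rfl, ?_⟩
  rw [Real.volume_eq_stieltjes_id, ← hFG, StieltjesFunction.measure_add]
  exact Measure.le_add_right le_rfl

theorem sum_mul_le_integral_posPart {f : ℝ → ℝ} (h0 : f 0 = 0)
    (hf : ∀ x y, f x - f y ≤ uNorm.dist y x) (c : ℝ →₀ ℝ) :
    (c.sum fun x a => a * f x) ≤ ∫ t, max (stepFun c t) 0 := by
  obtain ⟨F, hF, hle⟩ := exists_stieltjes_le_volume hf
  have h := integral_stepFun F c
  simp only [hF, h0, sub_zero] at h
  rw [← h]
  refine (integral_mono (integrable_stepFun _ c) (integrable_stepFun _ c).pos_part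
    fun t => le_max_left _ _).trans ?_
  exact integral_mono_measure hle (ae_of_all _ fun t => le_max_right _ _)
    (integrable_stepFun _ c).pos_part

/-- The primitive of the indicator of `{stepFun c > 0}` lies in the unit ball and attains the upper
bound of `sum_mul_le_integral_posPart`. -/
theorem exists_sum_mul_eq_integral_posPart (c : ℝ →₀ ℝ) :
    ∃ f : ℝ → ℝ, f 0 = 0 ∧ (∀ x y, f x - f y ≤ uNorm.dist y x) ∧
      (c.sum fun x a => a * f x) = ∫ t, max (stepFun c t) 0 := by
  set P : Set ℝ := {t | 0 < stepFun c t}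
  have hP : MeasurableSet P := measurableSet_lt measurable_const (measurable_stepFun c)
  have hint : ∀ x, Integrable (P.indicator (signedIndicator x)) volume :=
    fun x => (integrable_signedIndicator _ x).indicator hP
  have hdiff : ∀ a b, a ≤ b →
      (∫ t, P.indicator (signedIndicator b) t) - (∫ t, P.indicator (signedIndicator a) t) =
        ∫ t, P.indicator ((Set.Ioc a b).indicator fun _ => (1 : ℝ)) t := by
    intro a b hab
    rw [← integral_sub (hint b) (hint a)]
    refine integral_congr_ae (ae_of_all _ fun t => ?_)
    by_cases ht : t ∈ P
    · simp only [Set.indicator_of_mem ht, signedIndicator_sub hab]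
    · simp only [Set.indicator_of_notMem ht, sub_zero]
  refine ⟨fun x => ∫ t, P.indicator (signedIndicator x) t, ?_, fun x y => ?_, ?_⟩
  · have h0 : signedIndicator 0 = 0 := by
      ext t
      simp [signedIndicator]
    simp [h0]
  · rw [uNorm_dist_apply]
    rcases le_total x y with h | h
    · refine le_trans ?_ (le_max_right _ _)
      have h1 : 0 ≤ ∫ t, P.indicator ((Set.Ioc x y).indicator fun _ => (1 : ℝ)) t :=
        integral_nonneg fun t => Set.indicator_nonneg
          (fun t _ => Set.indicator_nonneg (fun _ _ => zero_le_one) t) t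
      rw [← hdiff x y h] at h1
      linarith
    · refine le_trans ?_ (le_max_left _ _)
      rw [hdiff y x h]
      refine (integral_mono ((integrable_indicator_Ioc _ y x).indicator hP)
        (integrable_indicator_Ioc _ y x) fun t => Set.indicator_le_self' (fun _ _ =>
          Set.indicator_nonneg (fun _ _ => zero_le_one) _) t).trans ?_
      rw [integral_indicator_const _ measurableSet_Ioc, Real.volume_real_Ioc_of_le h, smul_eq_mul,
        mul_one]
  · simp only [Finsupp.sum, ← integral_const_mul]
    rw [← integral_finsetSum _ fun x _ => (hint x).const_mul _]
    refine integral_congr_ae (ae_of_all _ fun t => ?_)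
    by_cases ht : t ∈ P
    · simp only [Set.indicator_of_mem ht]
      exact (max_eq_left (le_of_lt ht)).symm
    · simp only [Set.indicator_of_notMem ht, mul_zero, Finset.sum_const_zero]
      exact (max_eq_right (not_lt.1 ht)).symm

namespace QuasiHemiMetric

variable {X : Type*} (d : QuasiHemiMetric X) (x₀ : X)

/-- The functional `∑ c_x • δ_x`, as an element of the span of the evaluation functionals. -/
noncomputable def deltaComb : (X →₀ ℝ) →ₗ[ℝ] d.deltaSpan x₀ :=
  Finsupp.linearCombination ℝ fun x => ⟨d.delta x₀ x, Submodule.subset_span ⟨x, rfl⟩⟩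

theorem coe_deltaComb (c : X →₀ ℝ) :
    (d.deltaComb x₀ c : d.SLip₀ x₀ →ₗ[ℝ≥0] ℝ) = Finsupp.linearCombination ℝ (d.delta x₀) c := by
  have h := Finsupp.apply_linearCombination ℝ (d.deltaSpan x₀).subtype
    (fun x => (⟨d.delta x₀ x, Submodule.subset_span ⟨x, rfl⟩⟩ : d.deltaSpan x₀)) c
  exact h

theorem deltaComb_apply (c : X →₀ ℝ) (f : d.SLip₀ x₀) :
    (d.deltaComb x₀ c : d.SLip₀ x₀ →ₗ[ℝ≥0] ℝ) f = c.sum fun x a => a * f.1 x := by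
  rw [coe_deltaComb, Finsupp.linearCombination_apply, Finsupp.sum, LinearMap.sum_apply]
  rfl

theorem deltaComb_surjective : Function.Surjective (d.deltaComb x₀) := by
  rintro ⟨φ, hφ⟩
  obtain ⟨c, hc⟩ := (Finsupp.mem_span_range_iff_exists_finsupp).1 hφ
  refine ⟨c, Subtype.ext ?_⟩
  rw [coe_deltaComb, Finsupp.linearCombination_apply]
  exact hc

end QuasiHemiMetric

theorem deltaSpanNorm_deltaComb (c : ℝ →₀ ℝ) :
    uNorm.dist.deltaSpanNorm 0 (uNorm.dist.deltaComb 0 c) = ∫ t, max (stepFun c t) 0 := by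
  have hnn : 0 ≤ ∫ t, max (stepFun c t) 0 := integral_nonneg fun t => le_max_right _ _
  refine le_antisymm ((uNorm.dist.slip 0).dualNorm_le fun f hf => max_le ?_ hnn) ?_
  · rw [QuasiHemiMetric.deltaComb_apply]
    refine sum_mul_le_integral_posPart f.2.2 (fun x y => ?_) c
    exact (uNorm.dist.sub_le_slipNorm f.2.1 x y).trans
      (mul_le_of_le_one_left (uNorm.dist.nonneg _ _) hf)
  · obtain ⟨f, h0, hf, hsum⟩ := exists_sum_mul_eq_integral_posPart c
    have hf1 : ∀ x y, f x - f y ≤ 1 * uNorm.dist y x := fun x y => by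
      rw [one_mul]
      exact hf x y
    let g : uNorm.dist.SLip₀ 0 := ⟨f, ⟨1, one_pos, hf1⟩, h0⟩
    have hg : uNorm.dist.slip 0 g ≤ 1 := uNorm.dist.slipNorm_le zero_le_one hf1
    have h := (uNorm.dist.slip 0).le_dualNorm
      (uNorm.dist.deltaSpan_le_dualCone 0 _ (uNorm.dist.deltaComb 0 c).2) hg
    refine le_trans (le_of_eq ?_) ((le_max_left _ _).trans h)
    rw [QuasiHemiMetric.deltaComb_apply]
    exact hsum.symm

/-! ### Step functions in `L¹(ℝ)` -/

/-- The class of `signedIndicator x` in `L¹(ℝ)`. -/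
noncomputable def signedIndicatorL1 (x : ℝ) : Lp ℝ 1 (volume : Measure ℝ) :=
  indicatorConstLp 1 (measurableSet_Ioc (a := 0) (b := x)) measure_Ioc_lt_top.ne 1 -
    indicatorConstLp 1 (measurableSet_Ioc (a := x) (b := 0)) measure_Ioc_lt_top.ne 1

/-- The class of `stepFun c` in `L¹(ℝ)`, as a linear function of `c`. -/
noncomputable def stepL1 : (ℝ →₀ ℝ) →ₗ[ℝ] Lp ℝ 1 (volume : Measure ℝ) :=
  Finsupp.linearCombination ℝ signedIndicatorL1

theorem coeFn_signedIndicatorL1 (x : ℝ) : signedIndicatorL1 x =ᵐ[volume] signedIndicator x := by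
  refine (Lp.coeFn_sub _ _).trans ?_
  exact indicatorConstLp_coeFn.sub indicatorConstLp_coeFn

theorem coeFn_stepL1 (c : ℝ →₀ ℝ) : stepL1 c =ᵐ[volume] stepFun c := by
  induction c using Finsupp.induction_linear with
  | zero =>
    rw [map_zero]
    filter_upwards [Lp.coeFn_zero ℝ 1 (volume : Measure ℝ)] with t ht
    rw [ht]
    simp [stepFun]
  | add c c' h h' =>
    rw [map_add]
    filter_upwards [Lp.coeFn_add (stepL1 c) (stepL1 c'), h, h'] with t ht h1 h2
    rw [ht, Pi.add_apply, h1, h2]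
    exact (Finsupp.sum_add_index' (fun x => zero_mul _) (fun x a b => add_mul _ _ _)).symm
  | single x a =>
    rw [stepL1, Finsupp.linearCombination_single]
    filter_upwards [Lp.coeFn_smul a (signedIndicatorL1 x), coeFn_signedIndicatorL1 x] with t h1 h2
    rw [h1, Pi.smul_apply, h2, smul_eq_mul]
    exact (Finsupp.sum_single_index (h := fun y b => b * signedIndicator y t) (zero_mul _)).symm

theorem l1PlusNorm_stepL1 (c : ℝ →₀ ℝ) : l1PlusNorm (stepL1 c) = ∫ t, max (stepFun c t) 0 := by
  refine integral_congr_ae ?_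
  filter_upwards [coeFn_stepL1 c] with t ht
  rw [ht]

theorem indicatorConstLp_Ioc_mem_range_stepL1 (a b : ℝ) :
    indicatorConstLp 1 (measurableSet_Ioc (a := a) (b := b)) measure_Ioc_lt_top.ne (1 : ℝ) ∈
      LinearMap.range stepL1 := by
  -- The interval `(a, b]` is empty if `b < a`, hence equal to `(a, max a b]` in all cases.
  refine ⟨Finsupp.single (max a b) 1 - Finsupp.single a 1, ?_⟩
  have h : ∀ x, stepL1 (Finsupp.single x 1) = signedIndicatorL1 x := fun x => by
    rw [stepL1, Finsupp.linearCombination_single, one_smul]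
  have hIoc : Set.Ioc a (max a b) = Set.Ioc a b := by
    ext t
    simp only [Set.mem_Ioc]
    grind
  rw [map_sub, h, h]
  refine Lp.ext ?_
  filter_upwards [Lp.coeFn_sub (signedIndicatorL1 (max a b)) (signedIndicatorL1 a),
    coeFn_signedIndicatorL1 a, coeFn_signedIndicatorL1 (max a b),
    indicatorConstLp_coeFn (p := 1) (hs := measurableSet_Ioc (a := a) (b := b))
      (hμs := (measure_Ioc_lt_top (μ := volume)).ne) (c := (1 : ℝ))] with t h1 h2 h3 h4
  rw [h1, Pi.sub_apply, h2, h3, h4, signedIndicator_sub (le_max_left a b), hIoc]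

/-- A union of an increasing sequence of sets of finite measure, itself of finite measure, is the
limit of the sequence in `L¹`. -/
theorem tendsto_indicatorConstLp_iUnion {t : ℕ → Set ℝ} (ht : ∀ n, MeasurableSet (t n))
    (hmono : Monotone t) {s : Set ℝ} (hs : MeasurableSet s) (hst : ⋃ n, t n = s)
    (hμs : volume s ≠ ∞) (hμt : ∀ n, volume (t n) ≠ ∞) :
    Filter.Tendsto (fun n => indicatorConstLp 1 (ht n) (hμt n) (1 : ℝ)) Filter.atTop
      (nhds (indicatorConstLp 1 hs hμs 1)) := by
  subst hst
  refine tendsto_indicatorConstLp_set ENNReal.one_ne_top ?_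
  have h := tendsto_measure_iInter_atTop (μ := (volume : Measure ℝ))
    (s := fun n => (⋃ n, t n) \ t n) (fun n => (hs.diff (ht n)).nullMeasurableSet)
    (fun m n hmn => Set.sdiff_subset_sdiff_right (hmono hmn))
    ⟨0, measure_ne_top_of_subset Set.sdiff_subset hμs⟩
  have h0 : ⋂ n, (⋃ n, t n) \ t n = ∅ := by
    rw [← Set.sdiff_iUnion, Set.sdiff_self]
  rw [h0, measure_empty] at h
  refine h.congr fun n => ?_
  rw [Set.symmDiff_def, Set.sdiff_eq_empty.2 (Set.subset_iUnion t n)]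
  simp

/-- By Dynkin's lemma, applied inside a bounded interval, the closed span of the indicators of
intervals contains those of all Borel sets in that interval. -/
theorem indicatorConstLp_inter_Ioc_mem_closure (a b : ℝ) {s : Set ℝ} (hs : MeasurableSet s) :
    indicatorConstLp 1 (hs.inter (measurableSet_Ioc (a := a) (b := b)))
      (measure_ne_top_of_subset Set.inter_subset_right measure_Ioc_lt_top.ne) (1 : ℝ) ∈
      (LinearMap.range stepL1).topologicalClosure := by
  have hfin : ∀ s : Set ℝ, volume (s ∩ Set.Ioc a b) ≠ ∞ := fun s =>
    measure_ne_top_of_subset Set.inter_subset_right measure_Ioc_lt_top.ne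
  have hI : MeasurableSet (Set.Ioc a b) := measurableSet_Ioc
  have hIoc : ∀ a b : ℝ, indicatorConstLp 1 (measurableSet_Ioc (a := a) (b := b))
      measure_Ioc_lt_top.ne (1 : ℝ) ∈ (LinearMap.range stepL1).topologicalClosure := fun a b =>
    Submodule.le_topologicalClosure _ (indicatorConstLp_Ioc_mem_range_stepL1 a b)
  induction s, hs using MeasurableSpace.induction_on_inter
      (BorelSpace.measurable_eq.trans (borel_eq_generateFrom_Ioc ℝ)) (isPiSystem_Ioc id id) with
  | empty =>
    simp only [Set.empty_inter, indicatorConstLp_empty]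
    exact Submodule.zero_mem _
  | basic t ht =>
    obtain ⟨l, u, -, rfl⟩ := ht
    simp only [Set.Ioc_inter_Ioc]
    exact hIoc _ _
  | compl t ht h =>
    have hdisj : Disjoint (t ∩ Set.Ioc a b) (tᶜ ∩ Set.Ioc a b) :=
      disjoint_compl_right.mono Set.inter_subset_left Set.inter_subset_left
    have hadd := indicatorConstLp_disjoint_union (p := 1) (ht.inter hI) (ht.compl.inter hI)
      (hfin t) (hfin tᶜ) hdisj (1 : ℝ)
    simp only [← Set.union_inter_distrib_right, Set.union_compl_self, Set.univ_inter] at hadd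
    rw [← sub_eq_iff_eq_add'] at hadd
    rw [← hadd]
    exact Submodule.sub_mem _ (hIoc a b) h
  | iUnion f hdisj hf h =>
    have hU : ∀ n, MeasurableSet (⋃ i ∈ Finset.range n, f i) := fun n =>
      Finset.measurableSet_biUnion _ fun i _ => hf i
    have hmem : ∀ n, indicatorConstLp 1 ((hU n).inter hI) (hfin _) (1 : ℝ) ∈
        (LinearMap.range stepL1).topologicalClosure := by
      intro n
      induction n with
      | zero =>
        simp only [Finset.range_zero, Finset.notMem_empty, Set.iUnion_of_empty, Set.iUnion_empty,
          Set.empty_inter, indicatorConstLp_empty]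
        exact Submodule.zero_mem _
      | succ n ih =>
        have hd : Disjoint (f n ∩ Set.Ioc a b) ((⋃ i ∈ Finset.range n, f i) ∩ Set.Ioc a b) := by
          refine Disjoint.mono Set.inter_subset_left Set.inter_subset_left ?_
          simp only [Set.disjoint_iUnion_right, Finset.mem_range]
          exact fun i hi => hdisj hi.ne'
        have hadd := indicatorConstLp_disjoint_union (p := 1) ((hf n).inter hI) ((hU n).inter hI)
          (hfin _) (hfin _) hd (1 : ℝ)
        simp only [← Set.union_inter_distrib_right] at hadd
        simp only [Finset.range_add_one, Finset.set_biUnion_insert]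
        rw [hadd]
        exact Submodule.add_mem _ (h n) ih
    refine IsClosed.mem_of_tendsto (Submodule.isClosed_topologicalClosure _)
      (tendsto_indicatorConstLp_iUnion (fun n => (hU n).inter hI) (fun m n hmn => ?_) _ ?_ _
        fun n => hfin _) (Filter.Eventually.of_forall hmem)
    · exact Set.inter_subset_inter_left _
        (Set.biUnion_subset_biUnion_left (Finset.range_mono hmn))
    · rw [← Set.iUnion_inter]
      congr 1
      ext x
      simp only [Set.mem_iUnion, Finset.mem_range]
      exact ⟨fun ⟨_, i, _, hx⟩ => ⟨i, hx⟩, fun ⟨i, hx⟩ => ⟨i + 1, i, i.lt_succ_self, hx⟩⟩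

theorem denseRange_stepL1 : DenseRange stepL1 := by
  suffices h : ∀ g, g ∈ (LinearMap.range stepL1).topologicalClosure from fun g => by
    have := h g
    rwa [← SetLike.mem_coe, Submodule.topologicalClosure_coe] at this
  intro g
  induction g using Lp.induction ENNReal.one_ne_top with
  | indicatorConst c hs hμs =>
    rename_i s
    rw [Lp.simpleFunc.coe_indicatorConst]
    have hone : indicatorConstLp 1 hs hμs.ne (1 : ℝ) ∈
        (LinearMap.range stepL1).topologicalClosure := by
      refine IsClosed.mem_of_tendsto (Submodule.isClosed_topologicalClosure _)
        (tendsto_indicatorConstLp_iUnion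
          (fun n : ℕ => hs.inter (measurableSet_Ioc (a := -(n : ℝ)) (b := n)))
          (fun m n hmn => ?_) hs ?_ hμs.ne
          fun n => measure_ne_top_of_subset Set.inter_subset_left hμs.ne)
        (Filter.Eventually.of_forall fun n => indicatorConstLp_inter_Ioc_mem_closure _ _ hs)
      · have h : (m : ℝ) ≤ n := Nat.cast_le.2 hmn
        exact Set.inter_subset_inter_right _ (Set.Ioc_subset_Ioc (neg_le_neg h) h)
      · rw [← Set.inter_iUnion, Set.inter_eq_left]
        intro x _
        obtain ⟨n, hn⟩ := exists_nat_gt |x|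
        exact Set.mem_iUnion.2 ⟨n, (abs_lt.1 hn).1, (abs_lt.1 hn).2.le⟩
    have hsmul : indicatorConstLp 1 hs hμs.ne c = c • indicatorConstLp 1 hs hμs.ne (1 : ℝ) := by
      refine Lp.ext ?_
      filter_upwards [Lp.coeFn_smul c (indicatorConstLp 1 hs hμs.ne (1 : ℝ)),
        indicatorConstLp_coeFn (p := 1) (hs := hs) (hμs := hμs.ne) (c := c),
        indicatorConstLp_coeFn (p := 1) (hs := hs) (hμs := hμs.ne) (c := (1 : ℝ))] with t h1 h2 h3
      rw [h1, h2, Pi.smul_apply, h3]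
      by_cases ht : t ∈ s <;> simp [ht]
    rw [hsmul]
    exact Submodule.smul_mem _ c hone
  | add hf hg _ h h' => exact Submodule.add_mem _ h h'
  | isClosed => exact Submodule.isClosed_topologicalClosure _

/-! ### Passing to the completion -/

theorem norm_eq_l1PlusNorm_add_neg (g : Lp ℝ 1 (volume : Measure ℝ)) :
    ‖g‖ = l1PlusNorm g + l1PlusNorm (-g) := by
  have hneg : l1PlusNorm (-g) = ∫ x, max (-g x) 0 :=
    integral_congr_ae (by filter_upwards [Lp.coeFn_neg g] with x hx; rw [hx, Pi.neg_apply])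
  rw [hneg, L1.norm_eq_integral_norm]
  refine Eq.trans ?_ (integral_add (L1.integrable_coeFn g).pos_part (L1.integrable_coeFn g).neg_part)
  refine integral_congr_ae (ae_of_all _ fun x => ?_)
  exact (max_zero_add_max_neg_zero_eq_abs_self (g x)).symm

theorem continuous_l1PlusNorm : Continuous fun g => l1PlusNorm g := by
  refine (LipschitzWith.of_le_add_mul 1 fun g h => ?_).continuous
  have := l1PlusNorm.sub_le_symm g h
  rw [NNReal.coe_one, one_mul, dist_eq_norm, norm_eq_l1PlusNorm_add_neg]
  linarith

/-- The semi-Lipschitz free space of `(ℝ, u)`, with base point `0`, is isometrically isomorphic to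
`(L¹(ℝ), ‖·|_{1,+})`. -/
theorem mainTheorem5 :
    AsymHemiNorm.IsometricallyIsomorphic (uNorm.dist.freeNorm 0) l1PlusNorm := by
  set p := uNorm.dist.deltaSpanNorm 0
  let e : (ℝ →₀ ℝ) →ₗ[ℝ] p.Bicompletion := p.toBicompletion ∘ₗ uNorm.dist.deltaComb 0
  have he : DenseRange e := by
    have h := UniformSpace.Completion.denseRange_coe (α := p.Symm)
    exact (congrArg Dense
      ((uNorm.dist.deltaComb_surjective 0).range_comp p.toBicompletion)).mpr h
  have hplus : ∀ c, l1PlusNorm (stepL1 c) = p.extFun (e c) := fun c => by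
    rw [l1PlusNorm_stepL1, ← deltaSpanNorm_deltaComb]
    exact (p.extFun_coe _).symm
  have hnorm : ∀ c, ‖stepL1 c‖ = ‖e c‖ := fun c => by
    rw [norm_eq_l1PlusNorm_add_neg, ← p.extFun_add_neg, ← map_neg, ← map_neg, hplus, hplus]
  let Φ := (LinearEquiv.refl ℝ (ℝ →₀ ℝ)).extendOfIsometry e stepL1 he denseRange_stepL1 hnorm
  have hΦ : ∀ x, l1PlusNorm (Φ x) = p.extFun x := by
    refine he.induction ?_ (isClosed_eq (continuous_l1PlusNorm.comp Φ.continuous)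
      p.continuous_extFun)
    rintro _ ⟨c, rfl⟩
    rw [← hplus]
    exact congrArg _ (LinearEquiv.extendOfIsometry_eq ..)
  refine ⟨Φ.toLinearEquiv, fun x y => ?_⟩
  change l1PlusNorm (Φ y - Φ x) = p.extFun (y - x)
  rw [← map_sub, hΦ]
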